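/- Let $G$ be an étale groupoid whose object space $G^0$ is locally compact and Hausdorff. Let $X\colon G\leftarrow G$ be a groupoid correspondence, that is, a topological space with commuting continuous actions of $G$ on the left (anchor map $r$) and on the right (anchor map $s$), such that the right action is free and proper and $s\colon X\to G^0$ is a local homeomorphism. Let $\mathcal R\subseteq G^0$ be an open, $G$-invariant subset such that the map $r_*\colon X/G\to G^0$ induced by $r$ restricts to a proper map $r_*^{-1}(\mathcal R)\to\mathcal R$. An action of $(G,X,\mathcal R)$ on a topological space $Y$ consists of a continuous left action of $G$ on $Y$ with anchor map $r\colon Y\to G^0$ and a continuous, open map $X\times_{s,G^0,r}Y\to Y$, $(x,y)\mapsto x\cdot y$, such that: (1) $r(x\cdot y)=r(x)$ and $g\cdot(x\cdot y)=(g\cdot x)\cdot y$ whenever $s(g)=r(x)$ and $s(x)=r(y)$; (2) $x\cdot y=x'\cdot y'$ if and only if there is $g\in G$ with $x'=x\cdot g$ and $y=g\cdot y'$; (3) $r^{-1}(\mathcal R)\subseteq X\cdot Y:=\{x\cdot y : s(x)=r(y)\}$; (4) for every compact $K\subseteq X/G$, the set of all $x\cdot y$ with $[x]\in K$ and $s(x)=r(y)$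 is closed in $Y$. A map $\varphi\colon Y_1\to Y_2$ between two such actions is $(G,X)$-equivariant if $r\circ\varphi=r$, $\varphi(g\cdot y)=g\cdot\varphi(y)$ and $\varphi(x\cdot y)=x\cdot\varphi(y)$ whenever the products are defined, and $\varphi^{-1}(X\cdot Y_2)=X\cdot Y_1$. A groupoid model for $(G,X,\mathcal R)$ is an étale groupoid $M$ together with, for each topological space $Y$, a bijection between the actions of $(G,X,\mathcal R)$ on $Y$ and the continuous left actions of $M$ on $Y$, such that a continuous map between two spaces with actions of $(G,X,\mathcal R)$ is $(G,X)$-equivariant if and only if it is $M$-equivariant for the associated $M$-actions. Proposition. Let $M$ and $M'$ be two groupoid models for $(G,X,\mathcal R)$. Then there is a unique isomorphism of topological groupoids $h\colon M\to M'$ that is compatible with the bijections between actions: for every topological space $Y$ and every action of $(G,X,\mathcal R)$ on $Y$, the associated $M$-action on $Y$ is the one obtained from the associated $M'$-action by pulling back along $h$, that is, $\gamma\cdot y=h(\gamma)\cdot y$, and the anchor map of the $M$-action followed by $h|_{M^0}$ is the anchor map of the $M'$-action. -/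

import Mathlib

universe u

/-- A topological groupoid with object space `Obj` and arrow space `Arr`. The product
`mul g h` (written `g · h`) is defined for arrows with `src g = tgt h`. -/
structure TopGroupoid where
  Obj : Type u
  Arr : Type u
  [topObj : TopologicalSpace Obj]
  [topArr : TopologicalSpace Arr]
  src : Arr → Obj
  tgt : Arr → Obj
  one : Obj → Arr
  inv : Arr → Arr
  mul : ∀ g h : Arr, src g = tgt h → Arr
  src_one : ∀ x, src (one x) = x
  tgt_one : ∀ x, tgt (one x) = x
  src_inv : ∀ g, src (inv g) = tgt g
  tgt_inv : ∀ g, tgt (inv g) = src g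
  src_mul : ∀ g h e, src (mul g h e) = src h
  tgt_mul : ∀ g h e, tgt (mul g h e) = tgt g
  mul_assoc : ∀ g h k (e₁ : src g = tgt h) (e₂ : src h = tgt k),
    mul (mul g h e₁) k ((src_mul g h e₁).trans e₂) =
      mul g (mul h k e₂) (e₁.trans (tgt_mul h k e₂).symm)
  one_mul : ∀ g, mul (one (tgt g)) g (src_one (tgt g)) = g
  mul_one : ∀ g, mul g (one (src g)) (tgt_one (src g)).symm = g
  inv_mul : ∀ g, mul (inv g) g (src_inv g) = one (src g)
  mul_inv : ∀ g, mul g (inv g) (tgt_inv g).symm = one (tgt g)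
  continuous_src : Continuous src
  continuous_tgt : Continuous tgt
  continuous_one : Continuous one
  continuous_inv : Continuous inv
  continuous_mul : Continuous
    fun p : {p : Arr × Arr // src p.1 = tgt p.2} => mul p.1.1 p.1.2 p.2

attribute [instance] TopGroupoid.topObj TopGroupoid.topArr

namespace TopGroupoid

/-- A topological groupoid is étale if its source and range maps are local homeomorphisms. -/
structure IsEtale (G : TopGroupoid.{u}) : Prop where
  isLocalHomeomorph_src : IsLocalHomeomorph G.src
  isLocalHomeomorph_tgt : IsLocalHomeomorph G.tgt

/-- An étale groupoid is called locally compact if its object space is locally compact and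
Hausdorff. The arrow space need not be Hausdorff. -/
structure IsLocallyCompact (G : TopGroupoid.{u}) : Prop where
  locallyCompactSpace_obj : LocallyCompactSpace G.Obj
  t2Space_obj : T2Space G.Obj

/-- Invariance of a set of objects. -/
def IsInvariant (G : TopGroupoid.{u}) (R : Set G.Obj) : Prop :=
  ∀ g : G.Arr, G.src g ∈ R ↔ G.tgt g ∈ R

/-- A continuous left action of a topological groupoid on a space. -/
@[ext]
structure LeftAction (G : TopGroupoid.{u}) (Y : Type u) [TopologicalSpace Y] where
  anchor : Y → G.Obj
  act : ∀ (g : G.Arr) (y : Y), G.src g = anchor y → Y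
  anchor_act : ∀ g y e, anchor (act g y e) = G.tgt g
  one_act : ∀ y, act (G.one (anchor y)) y (G.src_one (anchor y)) = y
  mul_act : ∀ g h y (e₁ : G.src g = G.tgt h) (e₂ : G.src h = anchor y),
    act (G.mul g h e₁) y ((G.src_mul g h e₁).trans e₂) =
      act g (act h y e₂) (e₁.trans (anchor_act h y e₂).symm)
  continuous_anchor : Continuous anchor
  continuous_act : Continuous
    fun p : {p : G.Arr × Y // G.src p.1 = anchor p.2} => act p.1.1 p.1.2 p.2

/-- A continuous right action of a topological groupoid on a space. -/
structure RightAction (G : TopGroupoid.{u}) (Y : Type u) [TopologicalSpace Y] where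
  anchor : Y → G.Obj
  act : ∀ (y : Y) (g : G.Arr), anchor y = G.tgt g → Y
  anchor_act : ∀ y g e, anchor (act y g e) = G.src g
  act_one : ∀ y, act y (G.one (anchor y)) (G.tgt_one (anchor y)).symm = y
  act_mul : ∀ y g h (e₁ : anchor y = G.tgt g) (e₂ : G.src g = G.tgt h),
    act y (G.mul g h e₂) (e₁.trans (G.tgt_mul g h e₂).symm) =
      act (act y g e₁) h ((anchor_act y g e₁).trans e₂)
  continuous_anchor : Continuous anchor
  continuous_act : Continuous
    fun p : {p : Y × G.Arr // anchor p.1 = G.tgt p.2} => act p.1.1 p.1.2 p.2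

/-- Equivariance of a map between two spaces with left actions of `G`. -/
structure LeftAction.IsEquivariant {G : TopGroupoid.{u}} {Y Z : Type u} [TopologicalSpace Y]
    [TopologicalSpace Z] (a : LeftAction G Y) (b : LeftAction G Z) (φ : Y → Z) : Prop where
  anchor_map : ∀ y, b.anchor (φ y) = a.anchor y
  map_act : ∀ g y (e : G.src g = a.anchor y),
    φ (a.act g y e) = b.act g (φ y) (e.trans (anchor_map y).symm)

/-- An isomorphism of topological groupoids: homeomorphisms on arrows and on objects that
intertwine source, range, units and multiplication (hence also inverses). -/
@[ext]
structure Iso (M N : TopGroupoid.{u}) where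
  arr : M.Arr ≃ₜ N.Arr
  obj : M.Obj ≃ₜ N.Obj
  src_arr : ∀ g, N.src (arr g) = obj (M.src g)
  tgt_arr : ∀ g, N.tgt (arr g) = obj (M.tgt g)
  arr_one : ∀ x, arr (M.one x) = N.one (obj x)
  arr_mul : ∀ g h (e : M.src g = M.tgt h),
    arr (M.mul g h e) =
      N.mul (arr g) (arr h) ((src_arr g).trans ((congrArg obj e).trans (tgt_arr h).symm))

theorem LeftAction.act_congr {G : TopGroupoid.{u}} {Y : Type u} [TopologicalSpace Y]
    (a : LeftAction G Y) {g g' : G.Arr} {y y' : Y} (hg : g = g') (hy : y = y')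
    (e : G.src g = a.anchor y) (e' : G.src g' = a.anchor y') : a.act g y e = a.act g' y' e' := by
  subst hg hy
  rfl

/-- The action of `M` on `Y` obtained from an action of `N` through an isomorphism `h : M ≅ N`:
its anchor map is `h⁻¹ ∘ anchor` and `g` acts as `h g`. -/
def LeftAction.pullback {M N : TopGroupoid.{u}} {Y : Type u} [TopologicalSpace Y]
    (a : LeftAction N Y) (h : Iso M N) : LeftAction M Y where
  anchor y := h.obj.symm (a.anchor y)
  act g y e := a.act (h.arr g) y
    ((h.src_arr g).trans ((congrArg h.obj e).trans (h.obj.apply_symm_apply (a.anchor y))))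
  anchor_act g y e := by
    rw [a.anchor_act, h.tgt_arr, Homeomorph.symm_apply_apply]
  one_act y := by
    refine (a.act_congr ?_ rfl _ (N.src_one _)).trans (a.one_act y)
    rw [h.arr_one, Homeomorph.apply_symm_apply]
  mul_act g k y e₁ e₂ := by
    refine (a.act_congr (h.arr_mul g k e₁) rfl _ ?_).trans (a.mul_act _ _ _ _ _)
    rw [N.src_mul, h.src_arr, e₂, Homeomorph.apply_symm_apply]
  continuous_anchor := h.obj.symm.continuous.comp a.continuous_anchor
  continuous_act :=
    a.continuous_act.comp
      (Continuous.subtype_mk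
        (f := fun p : {p : M.Arr × Y // M.src p.1 = h.obj.symm (a.anchor p.2)} =>
          (h.arr p.1.1, p.1.2))
        (by fun_prop)
        (fun p => (h.src_arr p.1.1).trans
          ((congrArg h.obj p.2).trans (h.obj.apply_symm_apply (a.anchor p.1.2)))))

end TopGroupoid

open TopGroupoid in
/-- A groupoid correspondence `H ← G`: a space with commuting actions of `H` on the left and
of `G` on the right, such that the right action is free and proper and its anchor map is a
local homeomorphism. -/
structure GroupoidCorrespondence (H G : TopGroupoid.{u}) where
  Carrier : Type u
  [top : TopologicalSpace Carrier]
  left : LeftAction H Carrier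
  right : RightAction G Carrier
  right_anchor_left : ∀ h x e, right.anchor (left.act h x e) = right.anchor x
  left_anchor_right : ∀ x g e, left.anchor (right.act x g e) = left.anchor x
  left_right : ∀ h x g (e₁ : H.src h = left.anchor x) (e₂ : right.anchor x = G.tgt g),
    right.act (left.act h x e₁) g ((right_anchor_left h x e₁).trans e₂) =
      left.act h (right.act x g e₂) (e₁.trans (left_anchor_right x g e₂).symm)
  free : ∀ x g e, right.act x g e = x → g = G.one (right.anchor x)
  proper : IsProperMap fun p : {p : Carrier × G.Arr // right.anchor p.1 = G.tgt p.2} =>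
    (right.act p.1.1 p.1.2 p.2, p.1.1)
  isLocalHomeomorph_anchor : IsLocalHomeomorph right.anchor

attribute [instance] GroupoidCorrespondence.top

namespace GroupoidCorrespondence

variable {H G : TopGroupoid.{u}}

/-- The range map, that is, the anchor map of the left action. -/
abbrev r (X : GroupoidCorrespondence H G) : X.Carrier → H.Obj := X.left.anchor

/-- The source map, that is, the anchor map of the right action. -/
abbrev s (X : GroupoidCorrespondence H G) : X.Carrier → G.Obj := X.right.anchor

/-- The orbit equivalence relation of the right action. -/
def orbitSetoid (X : GroupoidCorrespondence H G) : Setoid X.Carrier where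
  r x x' := ∃ (g : G.Arr) (e : X.s x = G.tgt g), x' = X.right.act x g e
  iseqv :=
    { refl := fun x => ⟨G.one (X.s x), (G.tgt_one _).symm, (X.right.act_one x).symm⟩
      symm := by
        rintro x _ ⟨g, e, rfl⟩
        refine ⟨G.inv g, (X.right.anchor_act x g e).trans (G.tgt_inv g).symm, ?_⟩
        rw [← X.right.act_mul x g (G.inv g) e (G.tgt_inv g).symm]
        have key : ∀ k (e' : X.s x = G.tgt k), k = G.one (X.s x) → x = X.right.act x k e' := by
          rintro k e' rfl
          exact (X.right.act_one x).symm
        exact key _ _ ((G.mul_inv g).trans (congrArg G.one e.symm))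
      trans := by
        rintro x _ _ ⟨g, e, rfl⟩ ⟨k, e', rfl⟩
        have e₂ : G.src g = G.tgt k := (X.right.anchor_act x g e).symm.trans e'
        exact ⟨G.mul g k e₂, e.trans (G.tgt_mul g k e₂).symm, (X.right.act_mul x g k e e₂).symm⟩ }

/-- The orbit space `X/G`, with the quotient topology. -/
def Orbit (X : GroupoidCorrespondence H G) : Type u := Quotient X.orbitSetoid

instance (X : GroupoidCorrespondence H G) : TopologicalSpace X.Orbit :=
  inferInstanceAs (TopologicalSpace (Quotient X.orbitSetoid))

/-- The orbit space projection `X → X/G`. -/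
def toOrbit (X : GroupoidCorrespondence H G) (x : X.Carrier) : X.Orbit :=
  Quotient.mk X.orbitSetoid x

/-- The map `X/G → H⁰` induced by the range map. -/
def rOrbit (X : GroupoidCorrespondence H G) : X.Orbit → H.Obj :=
  Quotient.lift X.r (by
    rintro x _ ⟨g, e, rfl⟩
    exact (X.left_anchor_right x g e).symm)

/-- `X` is proper on `R` if `X/G → H⁰` restricts to a proper map from the preimage of `R`
to `R`. -/
def IsProperOn (X : GroupoidCorrespondence H G) (R : Set H.Obj) : Prop :=
  IsProperMap (R.restrictPreimage X.rOrbit)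

end GroupoidCorrespondence

open TopGroupoid in
/-- An action of `(G, X, R)` on a space `Y`: an action of `G` on `Y` and a continuous, open map
`(x, y) ↦ x · y` from the fibre product of `X` and `Y` over `G⁰` to `Y`. -/
structure CorrespondenceAction (G : TopGroupoid.{u}) (X : GroupoidCorrespondence G G)
    (R : Set G.Obj) (Y : Type u) [TopologicalSpace Y] extends LeftAction G Y where
  mu : ∀ (x : X.Carrier) (y : Y), X.s x = anchor y → Y
  continuous_mu : Continuous
    fun p : {p : X.Carrier × Y // X.s p.1 = anchor p.2} => mu p.1.1 p.1.2 p.2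
  isOpenMap_mu : IsOpenMap
    fun p : {p : X.Carrier × Y // X.s p.1 = anchor p.2} => mu p.1.1 p.1.2 p.2
  anchor_mu : ∀ x y e, anchor (mu x y e) = X.r x
  act_mu : ∀ g x y (e₁ : G.src g = X.r x) (e₂ : X.s x = anchor y),
    act g (mu x y e₂) (e₁.trans (anchor_mu x y e₂).symm) =
      mu (X.left.act g x e₁) y ((X.right_anchor_left g x e₁).trans e₂)
  mu_eq_mu_iff : ∀ x x' y y' (e : X.s x = anchor y) (e' : X.s x' = anchor y'),
    mu x y e = mu x' y' e' ↔
      ∃ (g : G.Arr) (e₁ : X.s x = G.tgt g) (e₂ : G.src g = anchor y'),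
        x' = X.right.act x g e₁ ∧ y = act g y' e₂
  mem_range_mu : ∀ z, anchor z ∈ R → ∃ x y e, mu x y e = z
  isClosed_mu : ∀ K : Set X.Orbit, IsCompact K →
    IsClosed {z : Y | ∃ x y e, X.toOrbit x ∈ K ∧ mu x y e = z}

namespace CorrespondenceAction

variable {G : TopGroupoid.{u}} {X : GroupoidCorrespondence G G} {R : Set G.Obj}

/-- The subset `X · Y` of `Y`, the image of the multiplication map. -/
def image {Y : Type u} [TopologicalSpace Y] (a : CorrespondenceAction G X R Y) : Set Y :=
  {z | ∃ x y e, a.mu x y e = z}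

/-- `(G, X)`-equivariance of a map between two spaces with actions of `(G, X, R)`. -/
structure IsEquivariant {Y Z : Type u} [TopologicalSpace Y] [TopologicalSpace Z]
    (a : CorrespondenceAction G X R Y) (b : CorrespondenceAction G X R Z) (φ : Y → Z) :
    Prop extends a.toLeftAction.IsEquivariant b.toLeftAction φ where
  map_mu : ∀ x y (e : X.s x = a.anchor y),
    φ (a.mu x y e) = b.mu x (φ y) (e.trans (anchor_map y).symm)
  preimage_image : φ ⁻¹' b.image = a.image

end CorrespondenceAction

/-- A groupoid model for `(G, X, R)`: an étale groupoid `M` together with bijections, for all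
spaces `Y`, between actions of `(G, X, R)` on `Y` and actions of `M` on `Y`, such that a
continuous map is `(G, X)`-equivariant if and only if it is `M`-equivariant for the associated
actions. -/
structure GroupoidModel (G : TopGroupoid.{u}) (X : GroupoidCorrespondence G G)
    (R : Set G.Obj) where
  M : TopGroupoid.{u}
  isEtale : M.IsEtale
  equiv : ∀ (Y : Type u) [TopologicalSpace Y], CorrespondenceAction G X R Y ≃ M.LeftAction Y
  natural : ∀ (Y Z : Type u) [TopologicalSpace Y] [TopologicalSpace Z]
    (a : CorrespondenceAction G X R Y) (b : CorrespondenceAction G X R Z) (φ : Y → Z),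
    Continuous φ → (a.IsEquivariant b φ ↔ (equiv Y a).IsEquivariant (equiv Z b) φ)

/-! A topological groupoid can be recovered from its actions and their continuous equivariant maps.
Composing the bijections of two models gives a bijection `T` between the actions of $M$ and of $N$
on all spaces that preserves and reflects equivariance, so it suffices to treat such a `T`.

On objects: every anchor map is equivariant to the canonical action on objects, so transporting that
action shows that anchors change by one fixed map (`anchor_equiv`). On arrows: the left
multiplication action of $N$ on its arrows corresponds to an action of $M$, and $g$ is sent to the
result of $g$ acting there on the unit at the image of its source. The source fibre over the anchor
of $y$ is generated by a unit, and $k \mapsto k\cdot y$ is an equivariant map from it that sends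
this unit to $y$. Naturality then shows that $g$ acts on any $y$ as its image does (`act_arrMap`).
Multiplicativity, invertibility and compatibility with the actions follow from this. Uniqueness
holds because $h(g) = h(g)\cdot 1$. -/

namespace TopGroupoid

theorem mul_congr {G : TopGroupoid.{u}} {g g' h h' : G.Arr} (hg : g = g') (hh : h = h')
    (e : G.src g = G.tgt h) (e' : G.src g' = G.tgt h') : G.mul g h e = G.mul g' h' e' := by
  subst hg hh
  rfl

/-- Multiplying by a unit on the right does nothing. -/
theorem mul_one_of_eq (G : TopGroupoid.{u}) (g : G.Arr) (x : G.Obj)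
    (e : G.src g = G.tgt (G.one x)) : G.mul g (G.one x) e = g := by
  have hx : G.src g = x := e.trans (G.tgt_one x)
  subst hx
  exact G.mul_one g

namespace LeftAction

theorem one_act_of_eq {G : TopGroupoid.{u}} {Y : Type u} [TopologicalSpace Y]
    (a : LeftAction G Y) (x : G.Obj) (y : Y) (e : G.src (G.one x) = a.anchor y) :
    a.act (G.one x) y e = y := by
  have hx : x = a.anchor y := (G.src_one x).symm.trans e
  subst hx
  exact a.one_act y

theorem ext_of_forall {G : TopGroupoid.{u}} {Y : Type u} [TopologicalSpace Y]
    {a b : LeftAction G Y} (hanchor : ∀ y, a.anchor y = b.anchor y)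
    (hact : ∀ g y e e', a.act g y e = b.act g y e') : a = b := by
  obtain ⟨p, f, _, _, _, _, _⟩ := a
  obtain ⟨q, k, _, _, _, _, _⟩ := b
  obtain rfl : p = q := funext hanchor
  obtain rfl : f = k := by
    funext g y e
    exact hact g y e e
  rfl

theorem act_eq_of_eq {G : TopGroupoid.{u}} {Y : Type u} [TopologicalSpace Y]
    {a b : LeftAction G Y} (hab : a = b) (g : G.Arr) (y : Y) (e : G.src g = a.anchor y)
    (e' : G.src g = b.anchor y) : a.act g y e = b.act g y e' := by
  subst hab
  rfl

end LeftAction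

/-! ### Canonical actions and the equivariant maps between them -/

/-- The canonical action of a groupoid on its object space. -/
def objAction (G : TopGroupoid.{u}) : LeftAction G G.Obj where
  anchor x := x
  act g _ _ := G.tgt g
  anchor_act _ _ _ := rfl
  one_act x := G.tgt_one x
  mul_act g h _ e₁ _ := G.tgt_mul g h e₁
  continuous_anchor := continuous_id
  continuous_act := G.continuous_tgt.comp (continuous_fst.comp continuous_subtype_val)

/-- The action of a groupoid on its arrow space by left multiplication. -/
def arrAction (G : TopGroupoid.{u}) : LeftAction G G.Arr where
  anchor := G.tgt
  act := G.mul
  anchor_act := G.tgt_mul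
  one_act := G.one_mul
  mul_act := G.mul_assoc
  continuous_anchor := G.continuous_tgt
  continuous_act := G.continuous_mul

/-- The action of a groupoid by left multiplication on the arrows with a given source. -/
def fiberAction (G : TopGroupoid.{u}) (x : G.Obj) : LeftAction G {k : G.Arr // G.src k = x} where
  anchor k := G.tgt k.1
  act g k e := ⟨G.mul g k.1 e, (G.src_mul g k.1 e).trans k.2⟩
  anchor_act g k e := G.tgt_mul g k.1 e
  one_act k := Subtype.ext (G.one_mul k.1)
  mul_act g h k e₁ e₂ := Subtype.ext (G.mul_assoc g h k.1 e₁ e₂)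
  continuous_anchor := G.continuous_tgt.comp continuous_subtype_val
  continuous_act := by
    refine Continuous.subtype_mk (G.continuous_mul.comp (Continuous.subtype_mk
      (f := fun p : {p : G.Arr × {k : G.Arr // G.src k = x} // G.src p.1 = G.tgt p.2.1} =>
        (p.1.1, p.1.2.1)) (by fun_prop) fun p => p.2)) _

namespace LeftAction

variable {G : TopGroupoid.{u}} {Y : Type u} [TopologicalSpace Y]

theorem isEquivariant_anchor (a : LeftAction G Y) :
    a.IsEquivariant G.objAction a.anchor where
  anchor_map _ := rfl
  map_act g y e := a.anchor_act g y e

/-- The orbit map of a point, defined on the arrows that may act on it. -/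
def orbitMap (a : LeftAction G Y) (y : Y) (k : {k : G.Arr // G.src k = a.anchor y}) : Y :=
  a.act k.1 y k.2

theorem continuous_orbitMap (a : LeftAction G Y) (y : Y) : Continuous (a.orbitMap y) :=
  a.continuous_act.comp (Continuous.subtype_mk
    (f := fun k : {k : G.Arr // G.src k = a.anchor y} => (k.1, y)) (by fun_prop) fun k => k.2)

/-- This is associativity of the action. The source fibre thus behaves as the free action on one
generator, its unit. -/
theorem isEquivariant_orbitMap (a : LeftAction G Y) (y : Y) :
    (G.fiberAction (a.anchor y)).IsEquivariant a (a.orbitMap y) where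
  anchor_map k := a.anchor_act k.1 y k.2
  map_act g k e := a.mul_act g k.1 y e k.2

end LeftAction

theorem isEquivariant_fiber_val (G : TopGroupoid.{u}) (x : G.Obj) :
    (G.fiberAction x).IsEquivariant G.arrAction Subtype.val where
  anchor_map _ := rfl
  map_act _ _ _ := rfl

/-! ### Reconstruction of a groupoid from its actions -/

/-- A bijection between the actions of two groupoids on all spaces that preserves and reflects
equivariance of continuous maps. -/
structure ActionEquiv (M N : TopGroupoid.{u}) where
  equiv : ∀ (Y : Type u) [TopologicalSpace Y], M.LeftAction Y ≃ N.LeftAction Y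
  natural : ∀ (Y Z : Type u) [TopologicalSpace Y] [TopologicalSpace Z]
    (a : M.LeftAction Y) (b : M.LeftAction Z) (φ : Y → Z),
    Continuous φ → (a.IsEquivariant b φ ↔ (equiv Y a).IsEquivariant (equiv Z b) φ)

namespace ActionEquiv

variable {M N : TopGroupoid.{u}}

/-- The inverse bijection. -/
def symm (T : ActionEquiv M N) : ActionEquiv N M where
  equiv Y _ := (T.equiv Y).symm
  natural Y Z _ _ a b φ hφ := by
    rw [T.natural Y Z _ _ φ hφ, Equiv.apply_symm_apply, Equiv.apply_symm_apply]

/-- The induced map on objects, the anchor map of the action on `M.Obj` that corresponds to the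
canonical one. -/
def objMap (T : ActionEquiv M N) : M.Obj → N.Obj := (T.equiv M.Obj M.objAction).anchor

theorem continuous_objMap (T : ActionEquiv M N) : Continuous T.objMap :=
  (T.equiv M.Obj M.objAction).continuous_anchor

/-- The anchor map is an equivariant map to the object space, and naturality keeps it equivariant
after transport. -/
theorem anchor_equiv (T : ActionEquiv M N) {Y : Type u} [TopologicalSpace Y]
    (a : M.LeftAction Y) (y : Y) : (T.equiv Y a).anchor y = T.objMap (a.anchor y) :=
  (((T.natural _ _ a M.objAction a.anchor a.continuous_anchor).1
    a.isEquivariant_anchor).anchor_map y).symm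

theorem objMap_symm_objMap (T : ActionEquiv M N) (x : M.Obj) :
    T.symm.objMap (T.objMap x) = x := by
  have h := T.symm.anchor_equiv (T.equiv M.Obj M.objAction) x
  have h' : T.symm.equiv M.Obj (T.equiv M.Obj M.objAction) = M.objAction :=
    (T.equiv M.Obj).symm_apply_apply _
  rw [h'] at h
  exact h.symm

theorem objMap_objMap_symm (T : ActionEquiv M N) (x : N.Obj) :
    T.objMap (T.symm.objMap x) = x :=
  T.symm.objMap_symm_objMap x

theorem src_eq_anchor_one (T : ActionEquiv M N) (g : M.Arr) :
    M.src g = (T.symm.equiv N.Arr N.arrAction).anchor (N.one (T.objMap (M.src g))) := by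
  rw [anchor_equiv]
  exact ((congrArg _ (N.tgt_one _)).trans (T.objMap_symm_objMap _)).symm

/-- The induced map on arrows: an arrow acts on a unit arrow of `N` through the action of `M` on
`N.Arr` that corresponds to left multiplication. -/
def arrMap (T : ActionEquiv M N) (g : M.Arr) : N.Arr :=
  (T.symm.equiv N.Arr N.arrAction).act g (N.one (T.objMap (M.src g))) (T.src_eq_anchor_one g)

theorem continuous_arrMap (T : ActionEquiv M N) : Continuous T.arrMap :=
  (T.symm.equiv N.Arr N.arrAction).continuous_act.comp (Continuous.subtype_mk
    (f := fun g : M.Arr => (g, N.one (T.objMap (M.src g))))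
    (continuous_id.prodMk (N.continuous_one.comp (T.continuous_objMap.comp M.continuous_src)))
    T.src_eq_anchor_one)

theorem tgt_arrMap (T : ActionEquiv M N) (g : M.Arr) :
    N.tgt (T.arrMap g) = T.objMap (M.tgt g) := by
  have h := (T.symm.equiv N.Arr N.arrAction).anchor_act g _ (T.src_eq_anchor_one g)
  rw [anchor_equiv] at h
  rw [← h, objMap_objMap_symm]
  rfl

/-- The image of an arrow may be computed in a single source fibre of `N`. -/
theorem exists_fiber_act (T : ActionEquiv M N) (g : M.Arr) (x : N.Obj)
    (hx : x = T.objMap (M.src g)) :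
    ∃ e : M.src g = (T.symm.equiv _ (N.fiberAction x)).anchor ⟨N.one x, N.src_one x⟩,
      ((T.symm.equiv _ (N.fiberAction x)).act g ⟨N.one x, N.src_one x⟩ e).1 = T.arrMap g := by
  -- The base point is a variable so that the lemma also applies at the anchor of a point, which
  -- equals the image of the source only propositionally.
  subst hx
  have hE := (T.symm.natural _ _ _ _ _ continuous_subtype_val).1
    (N.isEquivariant_fiber_val (T.objMap (M.src g)))
  have e := (T.src_eq_anchor_one g).trans
    (hE.anchor_map ⟨N.one (T.objMap (M.src g)), N.src_one _⟩)
  exact ⟨e, hE.map_act g _ e⟩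

/-- A transported action on all arrows does not visibly preserve sources; computing inside one
source fibre forces it. -/
theorem src_arrMap (T : ActionEquiv M N) (g : M.Arr) :
    N.src (T.arrMap g) = T.objMap (M.src g) := by
  obtain ⟨e, h⟩ := T.exists_fiber_act g _ rfl
  rw [← h]
  exact ((T.symm.equiv _ (N.fiberAction _)).act g _ e).2

/-- An arrow acts on any space as its image does in the corresponding action. -/
theorem act_arrMap (T : ActionEquiv M N) {Y : Type u} [TopologicalSpace Y]
    (a : M.LeftAction Y) (g : M.Arr) (y : Y) (e : M.src g = a.anchor y)
    (e' : N.src (T.arrMap g) = (T.equiv Y a).anchor y) :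
    (T.equiv Y a).act (T.arrMap g) y e' = a.act g y e := by
  -- The orbit map of `y`, carried back to `M`-actions, sends the unit to `y`; equivariance there
  -- compares the two actions.
  have hE := (T.symm.natural _ _ _ _ _ ((T.equiv Y a).continuous_orbitMap y)).1
    ((T.equiv Y a).isEquivariant_orbitMap y)
  obtain ⟨e₁, h⟩ := T.exists_fiber_act g ((T.equiv Y a).anchor y)
    (e'.symm.trans (T.src_arrMap g))
  have ha : T.symm.equiv Y (T.equiv Y a) = a := (T.equiv Y).symm_apply_apply a
  have h₁ := hE.map_act g _ e₁
  have hy : (T.equiv Y a).orbitMap y ⟨N.one ((T.equiv Y a).anchor y), N.src_one _⟩ = y :=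
    (T.equiv Y a).one_act y
  refine ((T.equiv Y a).act_congr h.symm rfl e'
    ((T.symm.equiv _ (N.fiberAction _)).act g _ e₁).2).trans (h₁.trans ?_)
  exact (LeftAction.act_eq_of_eq ha _ _ _ (by rw [hy]; exact e)).trans
    (a.act_congr rfl hy _ _)

theorem arrMap_one (T : ActionEquiv M N) (x : M.Obj) :
    T.arrMap (M.one x) = N.one (T.objMap x) := by
  refine (LeftAction.one_act_of_eq _ _ _ _).trans ?_
  rw [M.src_one]

/-- In the transported action $(gk)\cdot 1 = g\cdot(k\cdot 1)$, and by `act_arrMap` the outer $g$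
acts as left multiplication by its image. -/
theorem arrMap_mul (T : ActionEquiv M N) (g k : M.Arr) (e : M.src g = M.tgt k)
    (e' : N.src (T.arrMap g) = N.tgt (T.arrMap k)) :
    T.arrMap (M.mul g k e) = N.mul (T.arrMap g) (T.arrMap k) e' := by
  have hc : T.equiv N.Arr (T.symm.equiv N.Arr N.arrAction) = N.arrAction :=
    (T.equiv N.Arr).apply_symm_apply _
  have h₁ := (T.symm.equiv N.Arr N.arrAction).mul_act g k _ e (T.src_eq_anchor_one k)
  have h₂ : T.arrMap (M.mul g k e) = _ := LeftAction.act_congr _ rfl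
    (by rw [M.src_mul]) (T.src_eq_anchor_one (M.mul g k e))
    ((M.src_mul g k e).trans (T.src_eq_anchor_one k))
  refine h₂.trans (h₁.trans ?_)
  refine (T.act_arrMap _ g (T.arrMap k) _ ?_).symm.trans (LeftAction.act_eq_of_eq hc _ _ _ e')
  rw [hc]
  exact e'

/-- Applying `act_arrMap` in both directions, $g$ and its double image act alike on a unit of `M` by
left multiplication. -/
theorem arrMap_symm_arrMap (T : ActionEquiv M N) (g : M.Arr) :
    T.symm.arrMap (T.arrMap g) = g := by
  have ha : T.symm.equiv M.Arr (T.equiv M.Arr M.arrAction) = M.arrAction :=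
    (T.equiv M.Arr).symm_apply_apply _
  have e : M.src g = M.arrAction.anchor (M.one (M.src g)) := (M.tgt_one _).symm
  have e' : N.src (T.arrMap g) = (T.equiv M.Arr M.arrAction).anchor (M.one (M.src g)) := by
    rw [anchor_equiv, src_arrMap, ← e]
  have e'' : M.src (T.symm.arrMap (T.arrMap g)) = M.tgt (M.one (M.src g)) := by
    rw [src_arrMap, src_arrMap, objMap_symm_objMap, M.tgt_one]
  have h₁ := T.act_arrMap M.arrAction g _ e e'
  have h₂ := T.symm.act_arrMap (T.equiv M.Arr M.arrAction) (T.arrMap g) _ e'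
    (by rw [ha]; exact e'')
  have h₃ := (LeftAction.act_eq_of_eq ha _ _ _ e'').symm.trans (h₂.trans h₁)
  exact (M.mul_one_of_eq _ _ e'').symm.trans (h₃.trans (M.mul_one_of_eq _ _ e))

/-- The isomorphism of topological groupoids induced by an equivalence between their actions. -/
def toIso (T : ActionEquiv M N) : Iso M N where
  arr :=
    { toFun := T.arrMap
      invFun := T.symm.arrMap
      left_inv := T.arrMap_symm_arrMap
      right_inv := T.symm.arrMap_symm_arrMap
      continuous_toFun := T.continuous_arrMap
      continuous_invFun := T.symm.continuous_arrMap }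
  obj :=
    { toFun := T.objMap
      invFun := T.symm.objMap
      left_inv := T.objMap_symm_objMap
      right_inv := T.objMap_objMap_symm
      continuous_toFun := T.continuous_objMap
      continuous_invFun := T.symm.continuous_objMap }
  src_arr := T.src_arrMap
  tgt_arr := T.tgt_arrMap
  arr_one := T.arrMap_one
  arr_mul g k e := T.arrMap_mul g k e _

theorem pullback_toIso (T : ActionEquiv M N) {Y : Type u} [TopologicalSpace Y]
    (a : M.LeftAction Y) : (T.equiv Y a).pullback T.toIso = a := by
  refine LeftAction.ext_of_forall (fun y => ?_) fun g y _ e' => T.act_arrMap a g y e' _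
  exact (congrArg T.symm.objMap (T.anchor_equiv a y)).trans (T.objMap_symm_objMap _)

end ActionEquiv

/-! ### Uniqueness and the application to groupoid models -/

/-- An isomorphism is determined by the pullback of the action by left multiplication. -/
theorem Iso.eq_of_pullback_arrAction_eq {M N : TopGroupoid.{u}} {h k : Iso M N}
    (hhk : N.arrAction.pullback h = N.arrAction.pullback k) : h = k := by
  have hsymm : ∀ x, h.obj.symm x = k.obj.symm x := fun x => by
    have h₁ := congrArg (fun a => LeftAction.anchor a (N.one x)) hhk
    change h.obj.symm (N.tgt (N.one x)) = k.obj.symm (N.tgt (N.one x)) at h₁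
    rwa [N.tgt_one] at h₁
  have hobj : ∀ x, h.obj x = k.obj x := fun x => by
    have h₁ := hsymm (h.obj x)
    rw [Homeomorph.symm_apply_apply] at h₁
    rw [h₁, Homeomorph.apply_symm_apply, ← h₁]
  refine Iso.ext (Homeomorph.ext fun g => ?_) (Homeomorph.ext hobj)
  -- Both pullbacks are to act on the same unit arrow, so the anchor condition is checked for `h`
  -- and `k` at once.
  have e : ∀ l : Iso M N, l.obj (M.src g) = h.obj (M.src g) →
      M.src g = (N.arrAction.pullback l).anchor (N.one (h.obj (M.src g))) := fun l hl => by
    change _ = l.obj.symm (N.tgt _)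
    rw [N.tgt_one, ← hl, Homeomorph.symm_apply_apply]
  have h₁ := LeftAction.act_eq_of_eq hhk g _ (e h rfl) (e k (hobj _).symm)
  exact (N.mul_one_of_eq _ _ _).symm.trans (h₁.trans (N.mul_one_of_eq _ _ _))

end TopGroupoid

/-- Two groupoid models have equivalent actions. -/
def GroupoidModel.actionEquiv {G : TopGroupoid.{u}} {X : GroupoidCorrespondence G G}
    {R : Set G.Obj} (𝓜 𝓜' : GroupoidModel G X R) : TopGroupoid.ActionEquiv 𝓜.M 𝓜'.M where
  equiv Y _ := (𝓜.equiv Y).symm.trans (𝓜'.equiv Y)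
  natural Y Z _ _ a b φ hφ := by
    have h₁ := 𝓜.natural Y Z ((𝓜.equiv Y).symm a) ((𝓜.equiv Z).symm b) φ hφ
    rw [Equiv.apply_symm_apply, Equiv.apply_symm_apply] at h₁
    exact h₁.symm.trans (𝓜'.natural Y Z _ _ φ hφ)

theorem mainTheorem6 (G : TopGroupoid.{u}) (hG : G.IsEtale) (hGlc : G.IsLocallyCompact)
    (X : GroupoidCorrespondence G G) (R : Set G.Obj) (hRo : IsOpen R) (hRi : G.IsInvariant R)
    (hXR : X.IsProperOn R) (𝓜 𝓜' : GroupoidModel G X R) :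
    ∃! h : TopGroupoid.Iso 𝓜.M 𝓜'.M,
      ∀ (Y : Type u) [TopologicalSpace Y] (a : CorrespondenceAction G X R Y),
        (𝓜'.equiv Y a).pullback h = 𝓜.equiv Y a := by
  refine ⟨(𝓜.actionEquiv 𝓜').toIso, fun Y _ a => ?_, fun k hk => ?_⟩
  · have h := (𝓜.actionEquiv 𝓜').pullback_toIso (𝓜.equiv Y a)
    have ha : (𝓜.actionEquiv 𝓜').equiv Y (𝓜.equiv Y a) = 𝓜'.equiv Y a :=
      congrArg (𝓜'.equiv Y) ((𝓜.equiv Y).symm_apply_apply a)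
    rwa [ha] at h
  -- For uniqueness it suffices to test on the action of $(G,X,\mathcal R)$ that corresponds to left
  -- multiplication on the arrows of $M'$.
  · have h := (𝓜.actionEquiv 𝓜').pullback_toIso
      (𝓜.equiv _ ((𝓜'.equiv _).symm 𝓜'.M.arrAction))
    have ha : (𝓜.actionEquiv 𝓜').equiv _ (𝓜.equiv _ ((𝓜'.equiv _).symm 𝓜'.M.arrAction)) =
        𝓜'.M.arrAction :=
      (congrArg (𝓜'.equiv _) ((𝓜.equiv _).symm_apply_apply _)).trans
        ((𝓜'.equiv _).apply_symm_apply _)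
    rw [ha] at h
    have h' := hk _ ((𝓜'.equiv _).symm 𝓜'.M.arrAction)
    rw [Equiv.apply_symm_apply] at h'
    exact TopGroupoid.Iso.eq_of_pullback_arrAction_eq (h'.trans h.symm)
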